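/- Partitions are identified with their Young diagrams; the empty partition is allowed, $|\lambda|$ is the size of $\lambda$, $\lambda_i$ its $i$-th part and $\lambda'_i$ the length of its $i$-th column. The hook length of a box is one plus the number of boxes to its right in its row plus the number of boxes below it in its column. Let $t$ be a positive integer. A partition is a $t$-core if none of its hook lengths is divisible by $t$. Let $\mathcal P$ be the set of all partitions and $\mathcal C_t$ the set of all $t$-cores. For $\lambda\in\mathcal P$ let $s$ be the largest integer with $\lambda_s\ge s$ ($s=0$ if $\lambda$ is empty), and put $a_i=\lambda_i-i$, $b_i=\lambda'_i-i$ for $1\le i\le s$. Write $a_i=tq_i+r_i$ and $b_i=tq'_i+(t-r'_i-1)$ with integers $q_i,q'_i\ge 0$ and $0\le r_i,r'_i\le t-1$. The $t$-colored Frobenius partition $\mathfrak{CF}_t(\lambda)$ is the two-rowed array whose top row consists of the numbers $q_i$ with color $r_i$ and whose bottom row consists of the numbers $q'_i$ with color $r'_i$ $(1\le i\le s)$; here the rows of arrays are regarded as sets of (colored) numbers, equivalently as strictly decreasing sequences. For $0\le j\le t-1$ let $\mathfrak C_j(\lambda)$ be the two-rowed array formed by the entries of $\mathfrak{CF}_t(\lambda)$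 of color $j$, with the color dropped; let $u_j$ and $v_j$ be the lengths of its top and bottom rows and $w_j=u_j-v_j$. For a two-rowed array $A$ with top row $\alpha_1>\dots>\alpha_u\ge0$ and bottom row $\beta_1>\dots>\beta_v\ge0$ ($u\neq v$ allowed), let $W(A)$ be the partition whose parts are $\alpha_i+i-(u-v)$ for $1\le i\le u$, followed by the parts of the conjugate of the partition $(\beta_1-v+1,\beta_2-v+2,\dots,\beta_v)$, where zero parts are allowed and discarded. (This is the partition component of Wright's map.) **Theorem.** For every $\lambda\in\mathcal P$ there is exactly one $t$-core $\lambda^{(t)}$ such that, for each color $j$, the entries of color $j$ of $\mathfrak{CF}_t(\lambda^{(t)})$ are $w_j-1,\dots,1,0$ in the top row (and none in the bottom row) if $w_j>0$, are $-w_j-1,\dots,1,0$ in the bottom row (and none in the top row) if $w_j<0$, and there are none if $w_j=0$. With $\lambda_{(j)}=W(\mathfrak C_j(\lambda))$ for $0\le j\le t-1$, the map \[ \varphi:\mathcal P\to\mathcal C_t\times\mathcal P^t,\qquad \varphi(\lambda)=\bigl(\lambda^{(t)},(\lambda_{(0)},\lambda_{(1)},\dots,\lambda_{(t-1)})\bigr),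 \] is a bijection, and \[ |\lambda|=|\lambda^{(t)}|+t\sum_{j=0}^{t-1}|\lambda_{(j)}|\qquad\text{for all }\lambda\in\mathcal P . \] -/

import Mathlib

namespace LittlewoodFrobenius

/-- Partitions are represented by their Young diagrams (boxes `(i, j)` in row `i` and column `j`,
both counted from `0`); `YoungDiagram.card` is the size, `rowLen i` is the part `λ_{i+1}` and
`colLen j` is the part `λ'_{j+1}` of the conjugate. -/
abbrev Partition : Type := YoungDiagram

/-- The hook length of the box `(i, j)` of `μ`: the boxes to its right in row `i`, the boxes below
it in column `j`, and the box itself. (No subtraction is truncated when `(i, j) ∈ μ`.) -/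
def hookLength (μ : Partition) (i j : ℕ) : ℕ :=
  (μ.rowLen i - (j + 1)) + (μ.colLen j - (i + 1)) + 1

/-- `μ` is a `t`-core: no hook length is divisible by `t`. -/
def IsCore (t : ℕ) (μ : Partition) : Prop :=
  ∀ i j : ℕ, (i, j) ∈ μ → ¬ t ∣ hookLength μ i j

/-- The set of all `t`-core partitions. -/
abbrev Core (t : ℕ) : Type := {μ : Partition // IsCore t μ}

/-- A two-rowed array whose rows, possibly of different lengths, are strictly decreasing. Such a row
is the same thing as the finite set of its entries. -/
@[ext]
structure TwoRowed (α : Type) where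
  top : Finset α
  bottom : Finset α

/-- The side of the Durfee square: the largest `s ≥ 1` with `λ_s - s ≥ 0`, and `0` if there is
none. -/
def durfee (μ : Partition) : ℕ :=
  Nat.findGreatest (fun s => s ≤ μ.rowLen (s - 1)) μ.card

/-- The Frobenius partition of `μ`, with rows `λ_i - i` and `λ'_i - i` for `1 ≤ i ≤ s`. -/
def frobenius (μ : Partition) : TwoRowed ℕ where
  top := (Finset.range (durfee μ)).image fun i => μ.rowLen i - (i + 1)
  bottom := (Finset.range (durfee μ)).image fun i => μ.colLen i - (i + 1)

/-- The `t`-colored Frobenius partition of `μ`. The colored integer `k_j` is the pair `(k, j)`.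
An entry `a = t q + r` of the top row becomes `q_r`, and an entry `b = t q' + (t - r' - 1)` of the
bottom row becomes `q'_{r'}`, where `0 ≤ r, r' ≤ t - 1`. -/
def coloredFrobenius (t : ℕ) [NeZero t] (μ : Partition) : TwoRowed (ℕ × Fin t) where
  top := (frobenius μ).top.image fun a => (a / t, Fin.ofNat t a)
  bottom := (frobenius μ).bottom.image fun b => (b / t, (Fin.ofNat t b).rev)

/-- The two-rowed array of the entries of color `j`, with the color dropped. -/
def colorPart {t : ℕ} (A : TwoRowed (ℕ × Fin t)) (j : Fin t) : TwoRowed ℕ where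
  top := (A.top.filter fun x => x.2 = j).image Prod.fst
  bottom := (A.bottom.filter fun x => x.2 = j).image Prod.fst

/-- The difference `u - v` of the lengths of the rows. -/
def charge (A : TwoRowed ℕ) : ℤ := (A.top.card : ℤ) - (A.bottom.card : ℤ)

/-- The colored array that has, for each color `j`, the entries `(w_j - 1)_j, …, 0_j` in the top
row if `w_j > 0`, the entries `(-w_j - 1)_j, …, 0_j` in the bottom row if `w_j < 0`, and no entry
of color `j` if `w_j = 0`. -/
def coreArray {t : ℕ} (w : Fin t → ℤ) : TwoRowed (ℕ × Fin t) where
  top := Finset.univ.biUnion fun j => (Finset.range (w j).toNat).image fun k => (k, j)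
  bottom := Finset.univ.biUnion fun j => (Finset.range (-w j).toNat).image fun k => (k, j)

/-- The entries of a row in strictly decreasing order. -/
def decr (s : Finset ℕ) : List ℕ := s.sort (· ≥ ·)

/-- For `s = {c_1 > c_2 > ⋯ > c_n}` the list of the numbers `c_i + i + m - n`, `1 ≤ i ≤ n`. The
subtraction is never truncated, since `c_i ≥ n - i`. -/
def shiftedRow (s : Finset ℕ) (m : ℕ) : List ℕ :=
  (decr s).mapIdx fun i c => c + (i + 1) + m - s.card

theorem length_shiftedRow (s : Finset ℕ) (m : ℕ) : (shiftedRow s m).length = s.card := by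
  simp [shiftedRow, decr]

theorem shiftedRow_sorted (s : Finset ℕ) (m : ℕ) : (shiftedRow s m).SortedGE := by
  have h := (Finset.sortedGT_sort s).pairwise
  rw [List.sortedGE_iff_isChain, List.isChain_iff_getElem]
  intro i hi
  simp only [shiftedRow, decr, List.getElem_mapIdx]
  rw [shiftedRow, decr, List.length_mapIdx] at hi
  have := List.pairwise_iff_getElem.1 h i (i + 1) (by omega) hi (by omega)
  omega

theorem le_of_mem_shiftedRow (s : Finset ℕ) (m x : ℕ) (hx : x ∈ shiftedRow s m) : m ≤ x := by
  have h : (decr s).Pairwise (· > ·) := (Finset.sortedGT_sort s).pairwise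
  have key : ∀ k i : ℕ, ∀ hi : i < (decr s).length, i + 1 + k = (decr s).length →
      k ≤ (decr s)[i] := by
    intro k
    induction k with
    | zero => intros; omega
    | succ k ih =>
      intro i hi hk
      have h1 := ih (i + 1) (by omega) (by omega)
      have h2 := List.pairwise_iff_getElem.1 h i (i + 1) hi (by omega) (by omega)
      omega
  have hl : (decr s).length = s.card := by simp [decr]
  obtain ⟨i, hi, rfl⟩ := List.mem_iff_getElem.1 hx
  rw [length_shiftedRow] at hi
  have := key (s.card - (i + 1)) i (by omega) (by omega)
  simp only [shiftedRow, List.getElem_mapIdx]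
  omega

/-- The partition `ν = (b_1 - v + 1, b_2 - v + 2, …, b_v)` (zero parts allowed) of the bottom row. -/
def wrightNu (A : TwoRowed ℕ) : Partition :=
  YoungDiagram.ofRowLens (shiftedRow A.bottom 0) (shiftedRow_sorted A.bottom 0)

/-- The parts of the partition in Wright's map: `a_i + i - (u - v)` for `1 ≤ i ≤ u`, followed by
the parts of the conjugate of `ν`. -/
def wrightParts (A : TwoRowed ℕ) : List ℕ :=
  shiftedRow A.top A.bottom.card ++ (wrightNu A).transpose.rowLens

theorem wrightParts_sorted (A : TwoRowed ℕ) : (wrightParts A).SortedGE := by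
  rw [List.sortedGE_iff_pairwise, wrightParts, List.pairwise_append]
  refine ⟨(shiftedRow_sorted _ _).pairwise, (YoungDiagram.rowLens_sorted _).pairwise, ?_⟩
  intro x hx y hy
  refine le_trans ?_ (le_of_mem_shiftedRow _ _ x hx)
  obtain ⟨i, hi, rfl⟩ := List.mem_iff_getElem.1 hy
  rw [YoungDiagram.get_rowLens, YoungDiagram.rowLen_transpose]
  by_contra! hlt
  have hm := YoungDiagram.mem_iff_lt_colLen.2 hlt
  obtain ⟨hj, -⟩ := YoungDiagram.mem_ofRowLens.1 hm
  rw [length_shiftedRow] at hj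
  exact absurd hj (lt_irrefl _)

/-- The partition `μ` that Wright's map `A ↦ (Δ, μ)` assigns to the two-rowed array `A`. -/
def wright (A : TwoRowed ℕ) : Partition :=
  YoungDiagram.ofRowLens (wrightParts A) (wrightParts_sorted A)

/-- The pair `p = (λ^(t), (λ_(0), …, λ_(t-1)))` is built from `μ = λ` by the construction: split the
`t`-colored Frobenius partition of `λ` by color; `λ^(t)` is the `t`-core whose `t`-colored Frobenius
partition is the array of the numbers `w_j = u_j - v_j`, and `λ_(j)` is the image of the part of
color `j` under Wright's map. -/
def IsDecomposition (t : ℕ) [NeZero t] (μ : Partition) (p : Core t × (Fin t → Partition)) : Prop :=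
  coloredFrobenius t p.1.1
      = coreArray (fun j => charge (colorPart (coloredFrobenius t μ) j)) ∧
    ∀ j, p.2 j = wright (colorPart (coloredFrobenius t μ) j)

end LittlewoodFrobenius

namespace LittlewoodFrobenius

/-! ### Beads and gaps of a partition -/

/-! Place a partition and a charge `c` on the integer line: rows give beads, columns give gaps, and
together they partition `ℤ`. The bead set determines both the partition and `c`
(`range_bead_injective`). A two-rowed array also cuts out a subset of `ℤ`, its Maya diagram, and
Wright's map reads the partition and charge off that subset (`range_bead_wright`). Hence `A ↦
(wright A, charge A)` is a bijection onto partitions and integers, and Frobenius partitions are the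
arrays of charge `0`.

Coloring by residues cuts the Maya diagram into `t` runners (`mem_maya_runner`). Arrays thus
correspond to `t`-tuples of arrays, and charges add. Hook lengths are differences bead minus gap, so
`t`-cores are the partitions all of whose runners are packed downwards, that is, ground arrays
(`isCore_iff_runner`). So a partition amounts to runner charges `w_j` with sum `0`, which is the
same as a core, together with `t` arbitrary partitions.

For sizes, the energy of a Frobenius partition is the size of the partition. `energy_merge` splits
it over the runners, and on a runner it is the Wright size plus a term depending only on the charge.
A partition and its core have equal runner charges, so only the Wright sizes survive in the
difference. -/

/-- The `i`-th bead of the abacus of `μ` at charge `c`. -/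
def bead (μ : Partition) (c : ℤ) (i : ℕ) : ℤ := μ.rowLen i - i - 1 + c

/-- The `j`-th gap of the abacus of `μ` at charge `c`. -/
def gap (μ : Partition) (c : ℤ) (j : ℕ) : ℤ := j - μ.colLen j + c

/-- The inequalities `j < μ.rowLen i` and `i < μ.colLen j` hold or fail together, which fixes the
sign of the sum of their differences. -/
theorem mem_iff_gap_lt_bead (μ : Partition) (c : ℤ) (i j : ℕ) :
    (i, j) ∈ μ ↔ gap μ c j < bead μ c i := by
  have h₁ := YoungDiagram.mem_iff_lt_rowLen (μ := μ) (i := i) (j := j)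
  have h₂ := YoungDiagram.mem_iff_lt_colLen (μ := μ) (i := i) (j := j)
  by_cases h : (i, j) ∈ μ
  · have h₃ := h₁.1 h
    have h₄ := h₂.1 h
    simp only [h, gap, bead, true_iff]
    omega
  · have h₃ := mt h₁.2 h
    have h₄ := mt h₂.2 h
    simp only [h, gap, bead, false_iff]
    omega

theorem gap_ne_bead (μ : Partition) (c : ℤ) (i j : ℕ) : gap μ c j ≠ bead μ c i := by
  intro e
  have h₁ := YoungDiagram.mem_iff_lt_rowLen (μ := μ) (i := i) (j := j)
  have h₂ := YoungDiagram.mem_iff_lt_colLen (μ := μ) (i := i) (j := j)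
  have h := h₁.symm.trans h₂
  unfold gap bead at e
  omega

theorem exists_bead_or_exists_gap (μ : Partition) (c x : ℤ) :
    (∃ i, bead μ c i = x) ∨ ∃ j, gap μ c j = x := by
  have hex : ∃ i : ℕ, bead μ c i ≤ x := by
    refine ⟨μ.rowLen 0 + (c - x).toNat, ?_⟩
    have := μ.rowLen_anti 0 (μ.rowLen 0 + (c - x).toNat) (Nat.zero_le _)
    unfold bead
    omega
  classical
  have hi := Nat.find_spec hex
  have hmin : ∀ k < Nat.find hex, x < bead μ c k :=
    fun k hk => not_le.1 (Nat.find_min hex hk)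
  generalize Nat.find hex = i at hi hmin
  rcases hi.eq_or_lt with h | h
  · exact Or.inl ⟨i, h⟩
  right
  -- With `i` the first index whose bead is at most `x`, this column has length exactly `i`, so its
  -- gap is `x`.
  refine ⟨(x + i - c).toNat, ?_⟩
  unfold bead at *
  have hj : (((x + i - c).toNat : ℕ) : ℤ) = x + i - c := Int.toNat_of_nonneg (by omega)
  generalize (x + i - c).toNat = j at hj
  have h₁ : ¬ i < μ.colLen j := by
    rw [← YoungDiagram.mem_iff_lt_colLen, YoungDiagram.mem_iff_lt_rowLen]
    omega
  have h₂ : i ≤ μ.colLen j := by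
    rcases Nat.eq_zero_or_pos i with rfl | hpos
    · exact Nat.zero_le _
    have h₃ : (i - 1, j) ∈ μ := by
      have := hmin (i - 1) (by omega)
      rw [YoungDiagram.mem_iff_lt_rowLen]
      omega
    have := YoungDiagram.mem_iff_lt_colLen.1 h₃
    omega
  unfold gap
  omega

theorem notMem_range_bead_iff (μ : Partition) (c x : ℤ) :
    x ∉ Set.range (bead μ c) ↔ x ∈ Set.range (gap μ c) := by
  constructor
  · intro h
    exact (exists_bead_or_exists_gap μ c x).resolve_left h
  · rintro ⟨j, rfl⟩ ⟨i, hi⟩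
    exact gap_ne_bead μ c i j hi.symm

theorem bead_strictAnti (μ : Partition) (c : ℤ) : StrictAnti (bead μ c) := by
  intro i j hij
  have := μ.rowLen_anti i j hij.le
  unfold bead
  omega

theorem rowLen_eq_zero {μ : Partition} {i : ℕ} (h : μ.colLen 0 ≤ i) : μ.rowLen i = 0 := by
  by_contra h'
  have := YoungDiagram.mem_iff_lt_rowLen.2 (Nat.pos_of_ne_zero h')
  have := YoungDiagram.mem_iff_lt_colLen.1 this
  omega

theorem range_bead_injective {μ ν : Partition} {c d : ℤ}
    (h : Set.range (bead μ c) = Set.range (bead ν d)) : μ = ν ∧ c = d := by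
  have hmono : ∀ (κ : Partition) (e : ℤ), StrictMono fun i => -bead κ e i :=
    fun κ e i j hij => neg_lt_neg (bead_strictAnti κ e hij)
  have hr : ∀ (κ : Partition) (e : ℤ),
      Set.range (fun i => -bead κ e i) = Neg.neg '' Set.range (bead κ e) :=
    fun κ e => Set.range_comp Neg.neg (bead κ e)
  have hf := ((hmono μ c).range_inj (hmono ν d)).1 (by rw [hr, hr, h])
  have hb : ∀ i, bead μ c i = bead ν d i := fun i => neg_injective (congrFun hf i)
  have hcd : c = d := by
    -- Beyond both diagrams the rows are empty, and the bead shows the charge.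
    have := hb (max (μ.colLen 0) (ν.colLen 0))
    unfold bead at this
    rw [rowLen_eq_zero (le_max_left _ _), rowLen_eq_zero (le_max_right _ _)] at this
    omega
  refine ⟨?_, hcd⟩
  ext ⟨i, j⟩
  have := hb i
  unfold bead at this
  rw [YoungDiagram.mem_cells, YoungDiagram.mem_cells, YoungDiagram.mem_iff_lt_rowLen,
    YoungDiagram.mem_iff_lt_rowLen]
  omega

theorem hookLength_eq {μ : Partition} {i j : ℕ} (h : (i, j) ∈ μ) (c : ℤ) :
    (hookLength μ i j : ℤ) = bead μ c i - gap μ c j := by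
  have h₁ := YoungDiagram.mem_iff_lt_rowLen.1 h
  have h₂ := YoungDiagram.mem_iff_lt_colLen.1 h
  unfold hookLength bead gap
  omega

/-- A partition is a `t`-core if and only if its beads can be moved down freely on every runner of
the `t`-abacus. -/
theorem isCore_iff {t : ℕ} (ht : 0 < t) (μ : Partition) :
    IsCore t μ ↔
      ∀ (x : ℤ) (k : ℕ), x ∈ Set.range (bead μ 0) → x - t * k ∈ Set.range (bead μ 0) := by
  constructor
  · rintro hμ x k ⟨i, rfl⟩
    -- A position without a bead is a gap, and the box of this bead and gap would have hook length
    -- `t * k`.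
    by_contra hx
    obtain ⟨j, hj⟩ := (notMem_range_bead_iff _ _ _).1 hx
    have hle : gap μ 0 j ≤ bead μ 0 i := by
      rw [hj]
      have : (0 : ℤ) ≤ t * k := by positivity
      omega
    have hmem : (i, j) ∈ μ :=
      (mem_iff_gap_lt_bead μ 0 i j).2 (lt_of_le_of_ne hle (gap_ne_bead μ 0 i j))
    refine hμ i j hmem ⟨k, ?_⟩
    have := hookLength_eq hmem 0
    zify
    rw [this, hj]
    ring
  · rintro h i j hmem ⟨k, hk⟩
    have h₁ := hookLength_eq hmem 0
    obtain ⟨i', hi'⟩ := h (bead μ 0 i) k ⟨i, rfl⟩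
    refine gap_ne_bead μ 0 i' j ?_
    rw [hi']
    zify at hk
    linarith

theorem eq_bot_of_range_bead_isLowerSet {μ : Partition} {c : ℤ}
    (h : IsLowerSet (Set.range (bead μ c))) : μ = ⊥ := by
  rw [eq_bot_iff]
  rintro ⟨i, j⟩ hij
  have hlt := (mem_iff_gap_lt_bead μ c i j).1 hij
  obtain ⟨i', hi'⟩ := h hlt.le ⟨i, rfl⟩
  exact absurd hi'.symm (gap_ne_bead μ c i' j)

theorem range_bead_bot (c : ℤ) : Set.range (bead ⊥ c) = Set.Iio c := by
  have h0 : ∀ i, (⊥ : Partition).rowLen i = 0 := by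
    intro i
    by_contra h
    exact YoungDiagram.notMem_bot _ (YoungDiagram.mem_iff_lt_rowLen.2 (Nat.pos_of_ne_zero h))
  ext x
  simp only [Set.mem_range, bead, h0, Set.mem_Iio]
  constructor
  · rintro ⟨i, rfl⟩
    omega
  · intro hx
    exact ⟨(c - 1 - x).toNat, by omega⟩

/-! ### Maya diagrams of two-rowed arrays -/

/-- The Maya diagram of a two-rowed array: the nonnegative integers in the top row, and the negative
integers `-1 - b` for `b` not in the bottom row. -/
def maya (A : TwoRowed ℕ) : Set ℤ :=
  {x | (0 ≤ x ∧ x.toNat ∈ A.top) ∨ (x < 0 ∧ (-1 - x).toNat ∉ A.bottom)}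

theorem natCast_mem_maya {A : TwoRowed ℕ} {a : ℕ} : (a : ℤ) ∈ maya A ↔ a ∈ A.top := by
  simp only [maya, Set.mem_ofPred_eq, Int.toNat_natCast]
  constructor
  · rintro (h | h)
    · exact h.2
    · omega
  · exact fun h => Or.inl ⟨by omega, h⟩

theorem neg_one_sub_mem_maya {A : TwoRowed ℕ} {b : ℕ} : (-1 - b : ℤ) ∈ maya A ↔ b ∉ A.bottom := by
  have e : (-1 - (-1 - b : ℤ)).toNat = b := by omega
  simp only [maya, Set.mem_ofPred_eq, e]
  constructor
  · rintro (h | h)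
    · omega
    · exact h.2
  · exact fun h => Or.inr ⟨by omega, h⟩

theorem int_nonneg_or_neg (x : ℤ) : (∃ a : ℕ, x = a) ∨ ∃ b : ℕ, x = -1 - b := by
  rcases le_or_gt 0 x with h | h
  · exact Or.inl ⟨x.toNat, by omega⟩
  · exact Or.inr ⟨(-1 - x).toNat, by omega⟩

theorem maya_injective : Function.Injective maya := by
  intro A B h
  ext a
  · rw [← natCast_mem_maya, h, natCast_mem_maya]
  · rw [← not_iff_not, ← neg_one_sub_mem_maya, h, neg_one_sub_mem_maya]

/-- Beads are bounded above and gaps below, so only finitely many beads are nonnegative and finitely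
many gaps negative. -/
theorem exists_maya_eq_range_bead (μ : Partition) (c : ℤ) :
    ∃ A : TwoRowed ℕ, maya A = Set.range (bead μ c) := by
  have h₁ : {a : ℕ | (a : ℤ) ∈ Set.range (bead μ c)}.Finite := by
    refine (Set.finite_Iic (μ.rowLen 0 + c.toNat)).subset ?_
    rintro a ⟨i, hi⟩
    have := μ.rowLen_anti 0 i (Nat.zero_le _)
    unfold bead at hi
    simp only [Set.mem_Iic]
    omega
  have h₂ : {b : ℕ | (-1 - b : ℤ) ∈ Set.range (gap μ c)}.Finite := by
    refine (Set.finite_Iic (μ.colLen 0 + (-c).toNat)).subset ?_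
    rintro a ⟨i, hi⟩
    have := μ.colLen_anti 0 i (Nat.zero_le _)
    unfold gap at hi
    simp only [Set.mem_Iic]
    omega
  refine ⟨⟨h₁.toFinset, h₂.toFinset⟩, ?_⟩
  ext x
  rcases int_nonneg_or_neg x with ⟨a, rfl⟩ | ⟨b, rfl⟩
  · rw [natCast_mem_maya]
    simp
  · rw [neg_one_sub_mem_maya, Set.Finite.mem_toFinset, Set.mem_ofPred_eq, ← notMem_range_bead_iff,
      not_not]

theorem mem_durfee_iff (μ : Partition) (i : ℕ) : i < durfee μ ↔ (i, i) ∈ μ := by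
  rw [durfee]
  constructor
  · intro h
    have h0 : Nat.findGreatest (fun s => s ≤ μ.rowLen (s - 1)) μ.card ≠ 0 := by omega
    have := Nat.findGreatest_of_ne_zero rfl h0
    generalize Nat.findGreatest (fun s => s ≤ μ.rowLen (s - 1)) μ.card = s at *
    have hm : (s - 1, s - 1) ∈ μ := YoungDiagram.mem_iff_lt_rowLen.2 (by omega)
    exact μ.up_left_mem (by omega) (by omega) hm
  · intro h
    have h₁ := YoungDiagram.mem_iff_lt_rowLen.1 h
    refine Nat.lt_of_succ_le (Nat.le_findGreatest ?_ (by simpa using h₁))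
    -- The search bound `μ.card` loses nothing, since a row has at most `μ.card` boxes.
    have h₂ : i + 1 ≤ μ.rowLen i := h₁
    refine h₂.trans ?_
    rw [YoungDiagram.rowLen_eq_card]
    exact Finset.card_le_card (Finset.filter_subset _ _)

/-- At charge `0`, bead `i` is nonnegative, and gap `i` negative, exactly when the diagonal box `(i,
i)` lies in `μ`. -/
theorem maya_frobenius (μ : Partition) : maya (frobenius μ) = Set.range (bead μ 0) := by
  ext x
  rcases int_nonneg_or_neg x with ⟨a, rfl⟩ | ⟨b, rfl⟩
  · rw [natCast_mem_maya]
    simp only [frobenius, Finset.mem_image, Finset.mem_range, mem_durfee_iff,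
      YoungDiagram.mem_iff_lt_rowLen, Set.mem_range, bead]
    constructor <;> rintro ⟨i, hi⟩ <;> exact ⟨i, by omega⟩
  · rw [neg_one_sub_mem_maya, ← not_iff_not, not_not, notMem_range_bead_iff]
    simp only [frobenius, Finset.mem_image, Finset.mem_range, mem_durfee_iff,
      YoungDiagram.mem_iff_lt_colLen, Set.mem_range, gap]
    constructor <;> rintro ⟨i, hi⟩ <;> exact ⟨i, by omega⟩

/-! ### Wright's map -/

theorem rowLen_ofRowLens_eq_getD (w : List ℕ) (hw : w.SortedGE) (i : ℕ) :
    (YoungDiagram.ofRowLens w hw).rowLen i = w.getD i 0 := by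
  refine eq_of_forall_lt_iff fun j => ?_
  rw [← YoungDiagram.mem_iff_lt_rowLen, YoungDiagram.mem_ofRowLens]
  by_cases h : i < w.length <;> simp [h, List.getD]

theorem card_ofRowLens (w : List ℕ) (hw : w.SortedGE) :
    (YoungDiagram.ofRowLens w hw).card = w.sum := by
  have key : ∀ v : List ℕ, (YoungDiagram.cellsOfRowLens v).card = v.sum := by
    intro v
    induction v with
    | nil => rfl
    | cons a v ih =>
      rw [YoungDiagram.cellsOfRowLens, Finset.card_union_of_disjoint, Finset.card_map, ih]
      · simp
      · rw [Finset.disjoint_left]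
        rintro ⟨i, j⟩ h₁ h₂
        simp only [Finset.mem_product, Finset.mem_singleton] at h₁
        simp only [Finset.mem_map] at h₂
        obtain ⟨⟨p, q⟩, -, h⟩ := h₂
        have := congrArg Prod.fst h
        simp at this
        omega
  exact key w

theorem card_transpose (μ : Partition) : μ.transpose.card = μ.card := by
  simp [YoungDiagram.card, YoungDiagram.transpose]

theorem length_decr (s : Finset ℕ) : (decr s).length = s.card := by simp [decr]

theorem mem_decr {s : Finset ℕ} {a : ℕ} : a ∈ decr s ↔ a ∈ s := by simp [decr]

theorem card_le_getElem_decr (s : Finset ℕ) {i : ℕ} (hi : i < (decr s).length) :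
    s.card ≤ (decr s)[i] + (i + 1) := by
  have hi' : i < (shiftedRow s 1).length := by
    rw [length_shiftedRow, ← length_decr]
    exact hi
  have := le_of_mem_shiftedRow s 1 _ (List.getElem_mem hi')
  simp only [shiftedRow, List.getElem_mapIdx] at this
  omega

theorem getD_shiftedRow (s : Finset ℕ) (m : ℕ) {i : ℕ} (hi : i < (decr s).length) :
    ((shiftedRow s m).getD i 0 : ℤ) = (decr s)[i] + (i + 1) + m - s.card := by
  have h := card_le_getElem_decr s hi
  have hi' : i < (shiftedRow s m).length := by
    rw [length_shiftedRow, ← length_decr]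
    exact hi
  rw [List.getD_eq_getElem _ _ hi']
  simp only [shiftedRow, List.getElem_mapIdx]
  omega

/-- Doubled so that the triangular number needs no division. -/
theorem sum_shiftedRow (s : Finset ℕ) (m : ℕ) :
    2 * ((shiftedRow s m).sum : ℤ) =
      2 * (∑ a ∈ s, (a : ℤ)) + s.card * (s.card + 1) + 2 * s.card * (m - s.card) := by
  have h₁ : ((shiftedRow s m).sum : ℤ) =
      ∑ i : Fin (decr s).length, (((decr s)[i] : ℤ) + ((i : ℤ) + 1) + m - s.card) := by
    have hl : (shiftedRow s m).length = (decr s).length := by rw [length_shiftedRow, length_decr]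
    rw [← Fin.sum_univ_getElem, Nat.cast_sum, ← (finCongr hl.symm).sum_comp]
    refine Finset.sum_congr rfl fun i _ => ?_
    rw [Fin.getElem_fin, ← getD_shiftedRow s m i.2,
      List.getD_eq_getElem _ _ (hl.symm ▸ i.2 : (i : ℕ) < _)]
    rfl
  have h₂ : ∑ i : Fin (decr s).length, ((decr s)[i] : ℤ) = ∑ a ∈ s, (a : ℤ) := by
    have e : ((decr s : List ℕ) : Multiset ℕ) = s.val := Finset.sort_eq s _
    have := Fin.sum_univ_getElem (decr s)
    rw [← Nat.cast_sum, ← Nat.cast_sum]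
    congr 1
    refine this.trans ?_
    rw [← Multiset.sum_coe, e]
    exact Finset.sum_val s
  have h₃ : 2 * ∑ i : Fin (decr s).length, (((i : ℕ) : ℤ) + 1) = s.card * (s.card + 1) := by
    rw [Fin.sum_univ_eq_sum_range (fun i => (i : ℤ) + 1), length_decr]
    induction s.card with
    | zero => simp
    | succ n ih =>
      rw [Finset.sum_range_succ, mul_add, ih]
      push_cast
      ring
  rw [h₁]
  simp only [Finset.sum_sub_distrib, Finset.sum_add_distrib, Finset.sum_const, Finset.card_univ,
    Fintype.card_fin, length_decr, nsmul_eq_mul] at *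
  rw [h₂]
  linear_combination h₃

/-- The energy of a two-rowed array. For the Frobenius partition of `μ` it is the size of `μ`. -/
def energy (A : TwoRowed ℕ) : ℤ := ∑ a ∈ A.top, (a : ℤ) + ∑ b ∈ A.bottom, ((b : ℤ) + 1)

theorem two_mul_energy (A : TwoRowed ℕ) :
    2 * energy A = 2 * (wright A).card + charge A * (charge A - 1) := by
  have h₁ : (wright A).card =
      (shiftedRow A.top A.bottom.card).sum + (shiftedRow A.bottom 0).sum := by
    rw [wright, card_ofRowLens, wrightParts, List.sum_append]
    congr 1
    rw [← card_ofRowLens _ (YoungDiagram.rowLens_sorted _),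
      YoungDiagram.ofRowLens_to_rowLens_eq_self, card_transpose, wrightNu, card_ofRowLens]
  have h₂ := sum_shiftedRow A.top A.bottom.card
  have h₃ := sum_shiftedRow A.bottom 0
  rw [h₁, energy, charge, Finset.sum_add_distrib]
  push_cast at *
  simp only [Finset.sum_const, nsmul_eq_mul]
  linear_combination -h₂ - h₃

theorem rowLen_wright_add (A : TwoRowed ℕ) (k : ℕ) :
    (wright A).rowLen (A.top.card + k) = (wrightNu A).colLen k := by
  rw [wright, rowLen_ofRowLens_eq_getD, wrightParts,
    List.getD_append_right _ _ _ _ (by rw [length_shiftedRow]; omega), length_shiftedRow,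
    Nat.add_sub_cancel_left, ← YoungDiagram.rowLen_transpose,
    ← rowLen_ofRowLens_eq_getD _ (YoungDiagram.rowLens_sorted _),
    YoungDiagram.ofRowLens_to_rowLens_eq_self]

theorem bead_wright_of_lt (A : TwoRowed ℕ) {i : ℕ} (hi : i < (decr A.top).length) :
    bead (wright A) (charge A) i = (decr A.top)[i] := by
  have h := getD_shiftedRow A.top A.bottom.card hi
  rw [bead, wright, rowLen_ofRowLens_eq_getD, wrightParts,
    List.getD_append _ _ _ _ (by rwa [length_shiftedRow, ← length_decr]), h, charge]
  ring

/-- Conjugation exchanges beads and gaps by the reflection `x ↦ -1 - x`; these are the rows below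
the top part. -/
theorem bead_wright_add (A : TwoRowed ℕ) (k : ℕ) :
    bead (wright A) (charge A) (A.top.card + k) = -1 - gap (wrightNu A) A.bottom.card k := by
  rw [bead, rowLen_wright_add, charge, gap]
  push_cast
  ring

theorem natCast_mem_range_gap_wrightNu (A : TwoRowed ℕ) (b : ℕ) :
    (b : ℤ) ∈ Set.range (gap (wrightNu A) A.bottom.card) ↔ b ∉ A.bottom := by
  rw [← notMem_range_bead_iff, not_iff_not, ← mem_decr, List.mem_iff_getElem, Set.mem_range]
  have hb : ∀ (i : ℕ) (hi : i < (decr A.bottom).length),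
      bead (wrightNu A) A.bottom.card i = (decr A.bottom)[i] := by
    intro i hi
    rw [bead, wrightNu, rowLen_ofRowLens_eq_getD, getD_shiftedRow _ _ hi]
    push_cast
    ring
  constructor
  · rintro ⟨i, hi⟩
    by_cases h : i < (decr A.bottom).length
    · exact ⟨i, h, by exact_mod_cast (hb i h).symm.trans hi⟩
    · exfalso
      rw [length_decr] at h
      rw [bead, wrightNu, rowLen_ofRowLens_eq_getD,
        List.getD_eq_default _ _ (by rw [length_shiftedRow]; omega)] at hi
      omega
  · rintro ⟨i, h, rfl⟩
    exact ⟨i, hb i h⟩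

theorem gap_wrightNu_nonneg (A : TwoRowed ℕ) (k : ℕ) : 0 ≤ gap (wrightNu A) A.bottom.card k := by
  by_contra! h
  -- At charge `v = A.bottom.card`, the empty rows from index `v` on have beads at every negative
  -- integer; the index solves `-i - 1 + v = gap`.
  refine gap_ne_bead (wrightNu A) A.bottom.card (-1 - gap (wrightNu A) A.bottom.card k +
    A.bottom.card).toNat k ?_
  rw [bead, wrightNu, rowLen_ofRowLens_eq_getD,
    List.getD_eq_default _ _ (by rw [length_shiftedRow, ← wrightNu]; omega), ← wrightNu]
  omega

theorem range_bead_wright (A : TwoRowed ℕ) :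
    Set.range (bead (wright A) (charge A)) = maya A := by
  ext x
  constructor
  · rintro ⟨i, rfl⟩
    by_cases hi : i < (decr A.top).length
    · rw [bead_wright_of_lt A hi, natCast_mem_maya, ← mem_decr]
      exact List.getElem_mem hi
    · rw [length_decr, not_lt] at hi
      obtain ⟨k, rfl⟩ := Nat.exists_eq_add_of_le hi
      obtain ⟨b, hb⟩ := Int.eq_ofNat_of_zero_le (gap_wrightNu_nonneg A k)
      rw [bead_wright_add, hb, neg_one_sub_mem_maya, ← natCast_mem_range_gap_wrightNu]
      exact ⟨k, hb⟩
  · intro hx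
    rcases int_nonneg_or_neg x with ⟨a, rfl⟩ | ⟨b, rfl⟩
    · rw [natCast_mem_maya, ← mem_decr] at hx
      obtain ⟨i, hi, rfl⟩ := List.mem_iff_getElem.1 hx
      exact ⟨i, bead_wright_of_lt A hi⟩
    · rw [neg_one_sub_mem_maya, ← natCast_mem_range_gap_wrightNu] at hx
      obtain ⟨k, hk⟩ := hx
      exact ⟨A.top.card + k, by rw [bead_wright_add, hk]⟩

theorem wright_charge_injective {A B : TwoRowed ℕ} (h₁ : wright A = wright B)
    (h₂ : charge A = charge B) : A = B :=
  maya_injective (by rw [← range_bead_wright, ← range_bead_wright, h₁, h₂])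

/-- Wright's map is onto: every partition and every charge come from a two-rowed array. -/
theorem exists_wright_charge (μ : Partition) (c : ℤ) :
    ∃ A : TwoRowed ℕ, wright A = μ ∧ charge A = c := by
  obtain ⟨A, hA⟩ := exists_maya_eq_range_bead μ c
  exact ⟨A, range_bead_injective ((range_bead_wright A).trans hA)⟩

theorem wright_frobenius (μ : Partition) :
    wright (frobenius μ) = μ ∧ charge (frobenius μ) = 0 :=
  range_bead_injective ((range_bead_wright _).trans (maya_frobenius μ))

theorem frobenius_wright {A : TwoRowed ℕ} (h : charge A = 0) : frobenius (wright A) = A :=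
  wright_charge_injective (wright_frobenius _).1 ((wright_frobenius _).2.trans h.symm)

theorem frobenius_injective : Function.Injective frobenius :=
  Function.LeftInverse.injective (g := wright) fun μ => (wright_frobenius μ).1

theorem energy_frobenius (μ : Partition) : energy (frobenius μ) = μ.card := by
  have h := two_mul_energy (frobenius μ)
  rw [(wright_frobenius μ).1, (wright_frobenius μ).2] at h
  linarith

/-! ### Arrays with empty Wright partition -/

/-- The two-rowed array of charge `w` of least energy. -/
def ground (w : ℤ) : TwoRowed ℕ := ⟨Finset.range w.toNat, Finset.range (-w).toNat⟩

theorem maya_ground (w : ℤ) : maya (ground w) = Set.Iio w := by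
  ext x
  rcases int_nonneg_or_neg x with ⟨a, rfl⟩ | ⟨b, rfl⟩
  · rw [natCast_mem_maya]
    simp only [ground, Finset.mem_range, Set.mem_Iio]
    omega
  · rw [neg_one_sub_mem_maya]
    simp only [ground, Finset.mem_range, Set.mem_Iio]
    omega

theorem wright_ground (w : ℤ) : wright (ground w) = ⊥ ∧ charge (ground w) = w :=
  range_bead_injective
    ((range_bead_wright _).trans ((maya_ground w).trans (range_bead_bot w).symm))

theorem isLowerSet_maya_iff (A : TwoRowed ℕ) : IsLowerSet (maya A) ↔ A = ground (charge A) := by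
  constructor
  · intro h
    rw [← range_bead_wright] at h
    exact wright_charge_injective
      ((eq_bot_of_range_bead_isLowerSet h).trans (wright_ground _).1.symm) (wright_ground _).2.symm
  · intro h
    rw [h, maya_ground]
    exact isLowerSet_Iio _

theorem two_mul_energy_ground (w : ℤ) : 2 * energy (ground w) = w * (w - 1) := by
  rw [two_mul_energy, (wright_ground w).1, (wright_ground w).2]
  simp [YoungDiagram.card]

theorem energy_eq_card_wright_add (A : TwoRowed ℕ) :
    energy A = (wright A).card + energy (ground (charge A)) := by
  have h₁ := two_mul_energy A
  have h₂ := two_mul_energy_ground (charge A)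
  linarith

/-! ### Splitting a two-rowed array by colors -/

/-- The `t`-coloring of a two-rowed array. -/
def colored (t : ℕ) [NeZero t] (A : TwoRowed ℕ) : TwoRowed (ℕ × Fin t) where
  top := A.top.image fun a => (a / t, Fin.ofNat t a)
  bottom := A.bottom.image fun b => (b / t, (Fin.ofNat t b).rev)

theorem coloredFrobenius_eq (t : ℕ) [NeZero t] (μ : Partition) :
    coloredFrobenius t μ = colored t (frobenius μ) := rfl

theorem mem_colorPart_top {t : ℕ} {C : TwoRowed (ℕ × Fin t)} {j : Fin t} {q : ℕ} :
    q ∈ (colorPart C j).top ↔ (q, j) ∈ C.top := by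
  simp only [colorPart, Finset.mem_image, Finset.mem_filter]
  constructor
  · rintro ⟨⟨q, j⟩, ⟨h, rfl⟩, rfl⟩
    exact h
  · exact fun h => ⟨(q, j), ⟨h, rfl⟩, rfl⟩

theorem mem_colorPart_bottom {t : ℕ} {C : TwoRowed (ℕ × Fin t)} {j : Fin t} {q : ℕ} :
    q ∈ (colorPart C j).bottom ↔ (q, j) ∈ C.bottom := by
  simp only [colorPart, Finset.mem_image, Finset.mem_filter]
  constructor
  · rintro ⟨⟨q, j⟩, ⟨h, rfl⟩, rfl⟩
    exact h
  · exact fun h => ⟨(q, j), ⟨h, rfl⟩, rfl⟩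

theorem colorPart_injective {t : ℕ} :
    Function.Injective (colorPart : TwoRowed (ℕ × Fin t) → Fin t → TwoRowed ℕ) := by
  intro C D h
  ext ⟨q, j⟩
  · rw [← mem_colorPart_top, h, mem_colorPart_top]
  · rw [← mem_colorPart_bottom, h, mem_colorPart_bottom]

theorem colorPart_coreArray {t : ℕ} (w : Fin t → ℤ) (j : Fin t) :
    colorPart (coreArray w) j = ground (w j) := by
  ext q
  · rw [mem_colorPart_top]
    simp [coreArray, ground]
  · rw [mem_colorPart_bottom]
    simp [coreArray, ground]

theorem mem_colored_top {t : ℕ} [NeZero t] {A : TwoRowed ℕ} {q : ℕ} {j : Fin t} :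
    (q, j) ∈ (colored t A).top ↔ t * q + j ∈ A.top := by
  have ht : 0 < t := Nat.pos_of_neZero t
  simp only [colored, Finset.mem_image, Prod.mk.injEq, Fin.ext_iff, Fin.val_ofNat]
  constructor
  · rintro ⟨a, ha, rfl, hj⟩
    rwa [← hj, Nat.div_add_mod]
  · intro h
    refine ⟨_, h, ?_, ?_⟩
    · rw [Nat.mul_add_div ht, Nat.div_eq_of_lt j.2, add_zero]
    · rw [Nat.mul_add_mod, Nat.mod_eq_of_lt j.2]

theorem mem_colored_bottom {t : ℕ} [NeZero t] {A : TwoRowed ℕ} {q : ℕ} {j : Fin t} :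
    (q, j) ∈ (colored t A).bottom ↔ t * q + j.rev ∈ A.bottom := by
  have ht : 0 < t := Nat.pos_of_neZero t
  simp only [colored, Finset.mem_image, Prod.mk.injEq, Fin.rev_eq_iff]
  simp only [Fin.ext_iff, Fin.val_ofNat]
  constructor
  · rintro ⟨a, ha, rfl, hj⟩
    rwa [← hj, Nat.div_add_mod]
  · intro h
    refine ⟨_, h, ?_, ?_⟩
    · rw [Nat.mul_add_div ht, Nat.div_eq_of_lt j.rev.2, add_zero]
    · rw [Nat.mul_add_mod, Nat.mod_eq_of_lt j.rev.2]

/-- The array of the entries of `A` of color `j`. -/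
def runner (t : ℕ) [NeZero t] (A : TwoRowed ℕ) (j : Fin t) : TwoRowed ℕ :=
  colorPart (colored t A) j

theorem mem_runner_top {t : ℕ} [NeZero t] {A : TwoRowed ℕ} {q : ℕ} {j : Fin t} :
    q ∈ (runner t A j).top ↔ t * q + j ∈ A.top :=
  mem_colorPart_top.trans mem_colored_top

theorem mem_runner_bottom {t : ℕ} [NeZero t] {A : TwoRowed ℕ} {q : ℕ} {j : Fin t} :
    q ∈ (runner t A j).bottom ↔ t * q + j.rev ∈ A.bottom :=
  mem_colorPart_bottom.trans mem_colored_bottom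

theorem mem_maya_runner {t : ℕ} [NeZero t] {A : TwoRowed ℕ} {q : ℤ} {j : Fin t} :
    q ∈ maya (runner t A j) ↔ t * q + j ∈ maya A := by
  rcases int_nonneg_or_neg q with ⟨a, rfl⟩ | ⟨b, rfl⟩
  · rw [natCast_mem_maya, mem_runner_top, ← natCast_mem_maya]
    push_cast
    rfl
  -- Reflection turns residue `j` into `t - 1 - j`, hence the reversed colors in the bottom row.
  · have e : (t * (-1 - b) + j : ℤ) = -1 - ((t * b + j.rev : ℕ) : ℤ) := by
      have h := Fin.val_rev j
      have h' := j.2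
      have h'' : ((j.rev : ℕ) : ℤ) = t - 1 - j := by omega
      push_cast [h'']
      ring
    rw [neg_one_sub_mem_maya, mem_runner_bottom, e, neg_one_sub_mem_maya]

/-- The array with prescribed runners. -/
def merge {t : ℕ} (B : Fin t → TwoRowed ℕ) : TwoRowed ℕ where
  top := Finset.univ.biUnion fun j => (B j).top.image fun q => t * q + j
  bottom := Finset.univ.biUnion fun j => (B j).bottom.image fun q => t * q + j.rev

theorem mul_add_val_inj {t : ℕ} {q q' : ℕ} {j j' : Fin t} (h : t * q + j = t * q' + j') :
    q = q' ∧ j = j' := by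
  have ht : 0 < t := j.pos
  have h₁ := congrArg (· / t) h
  have h₂ := congrArg (· % t) h
  simp only [Nat.mul_add_div ht, Nat.mul_add_mod, Nat.div_eq_of_lt j.2, Nat.div_eq_of_lt j'.2,
    Nat.mod_eq_of_lt j.2, Nat.mod_eq_of_lt j'.2, add_zero] at h₁ h₂
  exact ⟨h₁, Fin.ext h₂⟩

theorem runner_merge {t : ℕ} [NeZero t] (B : Fin t → TwoRowed ℕ) : runner t (merge B) = B := by
  funext j
  ext q
  · rw [mem_runner_top]
    simp only [merge, Finset.mem_biUnion, Finset.mem_univ, true_and, Finset.mem_image]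
    constructor
    · rintro ⟨j', q', hq, h⟩
      obtain ⟨rfl, rfl⟩ := mul_add_val_inj h
      exact hq
    · exact fun h => ⟨j, q, h, rfl⟩
  · rw [mem_runner_bottom]
    simp only [merge, Finset.mem_biUnion, Finset.mem_univ, true_and, Finset.mem_image]
    constructor
    · rintro ⟨j', q', hq, h⟩
      obtain ⟨rfl, h'⟩ := mul_add_val_inj h
      rw [← Fin.rev_injective h']
      exact hq
    · exact fun h => ⟨j, q, h, rfl⟩

theorem runner_injective (t : ℕ) [NeZero t] : Function.Injective (runner t) := by
  have ht : 0 < t := Nat.pos_of_neZero t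
  intro A B h
  apply maya_injective
  ext x
  have e : (t : ℤ) * (x / t) + (⟨(x % t).toNat, by
      have := Int.emod_lt_of_pos x (by exact_mod_cast ht : (0 : ℤ) < t)
      omega⟩ : Fin t) = x := by
    have := Int.emod_nonneg x (by exact_mod_cast ht.ne' : (t : ℤ) ≠ 0)
    rw [Int.toNat_of_nonneg this, Int.mul_ediv_add_emod]
  rw [← e, ← mem_maya_runner, h, mem_maya_runner]

theorem merge_runner {t : ℕ} [NeZero t] (A : TwoRowed ℕ) : merge (runner t A) = A :=
  runner_injective t (runner_merge _)

theorem sum_merge_top {t : ℕ} (B : Fin t → TwoRowed ℕ) (f : ℕ → ℤ) :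
    ∑ a ∈ (merge B).top, f a = ∑ j, ∑ q ∈ (B j).top, f (t * q + j) := by
  rw [merge, Finset.sum_biUnion]
  · refine Finset.sum_congr rfl fun j _ => Finset.sum_image ?_
    exact fun q _ q' _ h => (mul_add_val_inj h).1
  · intro j _ j' _ hne
    rw [Function.onFun, Finset.disjoint_left]
    intro a h h'
    obtain ⟨q, -, rfl⟩ := Finset.mem_image.1 h
    obtain ⟨q', -, e⟩ := Finset.mem_image.1 h'
    exact hne (mul_add_val_inj e).2.symm

theorem sum_merge_bottom {t : ℕ} (B : Fin t → TwoRowed ℕ) (f : ℕ → ℤ) :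
    ∑ b ∈ (merge B).bottom, f b = ∑ j, ∑ q ∈ (B j).bottom, f (t * q + j.rev) := by
  rw [merge, Finset.sum_biUnion]
  · refine Finset.sum_congr rfl fun j _ => Finset.sum_image ?_
    exact fun q _ q' _ h => (mul_add_val_inj h).1
  · intro j _ j' _ hne
    rw [Function.onFun, Finset.disjoint_left]
    intro a h h'
    obtain ⟨q, -, rfl⟩ := Finset.mem_image.1 h
    obtain ⟨q', -, e⟩ := Finset.mem_image.1 h'
    exact hne (Fin.rev_injective (mul_add_val_inj e).2).symm

theorem charge_merge {t : ℕ} (B : Fin t → TwoRowed ℕ) : charge (merge B) = ∑ j, charge (B j) := by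
  have h₁ := sum_merge_top B fun _ => 1
  have h₂ := sum_merge_bottom B fun _ => 1
  simp only [Finset.sum_const, nsmul_eq_mul, mul_one] at h₁ h₂
  simp only [charge, h₁, h₂, Finset.sum_sub_distrib]

/-- A top entry contributes `t q + j` and a bottom entry `t (q + 1) - j`, so the `j` terms add up to
`j` times the charge. -/
theorem energy_merge {t : ℕ} (B : Fin t → TwoRowed ℕ) :
    energy (merge B) = ∑ j : Fin t, (t * energy (B j) + j * charge (B j)) := by
  rw [energy, sum_merge_top B fun a => (a : ℤ), sum_merge_bottom B fun b => (b : ℤ) + 1,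
    ← Finset.sum_add_distrib]
  refine Finset.sum_congr rfl fun j _ => ?_
  have h := Fin.val_rev j
  have h' := j.2
  have h'' : ((j.rev : ℕ) : ℤ) = t - 1 - j := by omega
  push_cast [h'']
  simp only [energy, charge, Finset.sum_add_distrib, Finset.sum_const, nsmul_eq_mul, mul_add,
    ← Finset.mul_sum]
  ring

/-! ### Cores -/

theorem isCore_iff_runner (t : ℕ) [NeZero t] (μ : Partition) :
    IsCore t μ ↔
      ∀ j, runner t (frobenius μ) j = ground (charge (runner t (frobenius μ) j)) := by
  have ht : 0 < t := Nat.pos_of_neZero t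
  simp only [← isLowerSet_maya_iff, isCore_iff ht, ← maya_frobenius]
  constructor
  · intro h j q q' hle hq
    rw [mem_maya_runner] at hq ⊢
    have := h _ (q - q').toNat hq
    rw [Int.toNat_of_nonneg (by omega)] at this
    convert this using 1
    ring
  · intro h x k hx
    have h₁ := Int.emod_nonneg x (by exact_mod_cast ht.ne' : (t : ℤ) ≠ 0)
    have h₂ := Int.emod_lt_of_pos x (by exact_mod_cast ht : (0 : ℤ) < t)
    obtain ⟨j, hj⟩ : ∃ j : Fin t, ((j : ℕ) : ℤ) = x % t :=
      ⟨⟨(x % t).toNat, by omega⟩, Int.toNat_of_nonneg h₁⟩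
    have e : x = t * (x / t) + j := by rw [hj, Int.mul_ediv_add_emod]
    rw [e, ← mem_maya_runner] at hx
    have := h j (show x / t - k ≤ x / t by omega) hx
    rw [mem_maya_runner] at this
    convert this using 1
    linear_combination e

theorem coloredFrobenius_injective (t : ℕ) [NeZero t] :
    Function.Injective (coloredFrobenius t) := by
  intro μ ν h
  refine frobenius_injective (runner_injective t ?_)
  exact congrArg colorPart h

theorem coloredFrobenius_eq_coreArray_iff (t : ℕ) [NeZero t] (μ : Partition) (w : Fin t → ℤ) :
    coloredFrobenius t μ = coreArray w ↔ ∀ j, runner t (frobenius μ) j = ground (w j) := by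
  rw [← colorPart_injective.eq_iff, funext_iff]
  simp only [colorPart_coreArray]
  rfl

theorem sum_charge_runner_frobenius (t : ℕ) [NeZero t] (μ : Partition) :
    ∑ j, charge (runner t (frobenius μ) j) = 0 := by
  rw [← charge_merge, merge_runner, (wright_frobenius μ).2]

/-- Total charge `0` is what makes the merged ground arrays a Frobenius partition. -/
theorem exists_core (t : ℕ) [NeZero t] {w : Fin t → ℤ} (hw : ∑ j, w j = 0) :
    ∃ κ : Core t, coloredFrobenius t κ.1 = coreArray w := by
  have hr : ∀ j, runner t (frobenius (wright (merge fun j => ground (w j)))) j = ground (w j) := by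
    intro j
    rw [frobenius_wright, runner_merge]
    rw [charge_merge, ← hw]
    exact Finset.sum_congr rfl fun j _ => (wright_ground _).2
  refine ⟨⟨wright (merge fun j => ground (w j)), (isCore_iff_runner t _).2 fun j => ?_⟩,
    (coloredFrobenius_eq_coreArray_iff t _ w).2 hr⟩
  rw [hr, (wright_ground _).2]

theorem card_eq_of_isDecomposition {t : ℕ} [NeZero t] {μ : Partition}
    {p : Core t × (Fin t → Partition)} (h : IsDecomposition t μ p) :
    μ.card = p.1.1.card + t * ∑ j, (p.2 j).card := by
  obtain ⟨h₁, h₂⟩ := h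
  have h₃ := (coloredFrobenius_eq_coreArray_iff t _ _).1 h₁
  have h₄ : ∀ j, p.2 j = wright (runner t (frobenius μ) j) := h₂
  have e : ∀ ν : Partition, (ν.card : ℤ) = ∑ j : Fin t, (t * energy (runner t (frobenius ν) j) +
      j * charge (runner t (frobenius ν) j)) := by
    intro ν
    rw [← energy_merge, merge_runner, energy_frobenius]
  zify
  rw [e μ, e p.1.1, Finset.mul_sum, ← Finset.sum_add_distrib]
  refine Finset.sum_congr rfl fun j _ => ?_
  rw [h₄, h₃, (wright_ground _).2, energy_eq_card_wright_add (runner t (frobenius μ) j)]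
  rw [runner, ← coloredFrobenius_eq]
  ring

theorem existsUnique_isDecomposition (t : ℕ) [NeZero t] (μ : Partition) :
    ∃! p, IsDecomposition t μ p := by
  obtain ⟨κ, hκ⟩ := exists_core t (sum_charge_runner_frobenius t μ)
  refine ⟨(κ, fun j => wright (runner t (frobenius μ) j)), ⟨hκ, fun j => rfl⟩, ?_⟩
  rintro ⟨κ', q⟩ ⟨h₁, h₂⟩
  exact Prod.ext (Subtype.ext (coloredFrobenius_injective t (h₁.trans hκ.symm))) (funext h₂)

theorem isDecomposition_injective {t : ℕ} [NeZero t] {μ ν : Partition}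
    {p : Core t × (Fin t → Partition)} (hμ : IsDecomposition t μ p) (hν : IsDecomposition t ν p) :
    μ = ν := by
  refine coloredFrobenius_injective t (colorPart_injective (funext fun j => ?_))
  refine wright_charge_injective ((hμ.2 j).symm.trans (hν.2 j)) ?_
  have h := congrArg (fun C => charge (colorPart C j)) (hμ.1.symm.trans hν.1)
  simpa only [colorPart_coreArray, (wright_ground _).2] using h

theorem exists_isDecomposition {t : ℕ} [NeZero t] (p : Core t × (Fin t → Partition)) :
    ∃ μ, IsDecomposition t μ p := by
  -- Each runner gets its quotient partition at the charge of the core's runner, so the total charge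
  -- stays `0`.
  choose B hB₁ hB₂ using
    fun j => exists_wright_charge (p.2 j) (charge (runner t (frobenius p.1.1) j))
  have h : runner t (frobenius (wright (merge B))) = B := by
    rw [frobenius_wright, runner_merge]
    rw [charge_merge, ← sum_charge_runner_frobenius t p.1.1]
    exact Finset.sum_congr rfl fun j _ => hB₂ j
  have h' : ∀ j, colorPart (coloredFrobenius t (wright (merge B))) j = B j := congrFun h
  refine ⟨wright (merge B), ?_, fun j => ?_⟩
  · simp only [h', hB₂]
    exact (coloredFrobenius_eq_coreArray_iff t _ _).2 ((isCore_iff_runner t _).1 p.1.2)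
  · rw [h', hB₁]

end LittlewoodFrobenius

theorem theorem1p1 (t : ℕ) [NeZero t] :
    ∃ φ : LittlewoodFrobenius.Partition →
        LittlewoodFrobenius.Core t × (Fin t → LittlewoodFrobenius.Partition),
      (∀ μ p, LittlewoodFrobenius.IsDecomposition t μ p ↔ p = φ μ) ∧
        Function.Bijective φ ∧
          ∀ μ, μ.card = (φ μ).1.1.card + t * ∑ j, ((φ μ).2 j).card := by
  choose φ hφ huniq using LittlewoodFrobenius.existsUnique_isDecomposition t
  have hiff : ∀ μ p, LittlewoodFrobenius.IsDecomposition t μ p ↔ p = φ μ :=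
    fun μ p => ⟨huniq μ p, fun h => h ▸ hφ μ⟩
  refine ⟨φ, hiff, ⟨fun μ ν h => ?_, fun p => ?_⟩,
    fun μ => LittlewoodFrobenius.card_eq_of_isDecomposition (hφ μ)⟩
  · exact LittlewoodFrobenius.isDecomposition_injective (hφ μ) (h ▸ hφ ν)
  · obtain ⟨μ, hμ⟩ := LittlewoodFrobenius.exists_isDecomposition p
    exact ⟨μ, ((hiff μ p).1 hμ).symm⟩
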